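/- For an ordinal $\alpha$ let $V_\alpha$ be the $\alpha$-th stage of the cumulative hierarchy, and for a cardinal $\kappa$ let $H_\kappa$ be the set of all sets whose transitive closure has cardinality less than $\kappa$. "Definable over $(M,\in)$" means first-order definable over $(M,\in)$ with parameters from $M$. A cardinal $\kappa$ is $\Pi^1_1$ reflecting if $\kappa$ is (strongly) inaccessible and, for every $A\subseteq V_\kappa$ that is definable over $(V_\kappa,\in)$ and every $\Pi^1_1$ sentence $\Phi$ with $(V_\kappa,\in,A)\models\Phi$, there is an $\alpha<\kappa$ such that $(V_\alpha,\in,A\cap V_\alpha)\models\Phi$. Here a $\Pi^1_1$ sentence is one of the form $\forall X_1\cdots\forall X_n\,\varphi$, where the $X_i$ range over all subsets of the structure and $\varphi$ is first-order in $\in$, $A$ and the predicates $X_i$. A tree is a partially ordered set $(T,<_T)$ in which the set of predecessors of each element is well-ordered by $<_T$, and which has a root, i.e. an element $r$ with $r<_T t$ for all $t\in T$, $t\neq r$. Its $\alpha$-th level $T_\alpha$ is the set of elements whose set of predecessors has order type $\alpha$. It is a $\kappa$-tree if $|T|=\kappa$, it has height $\kappa$ (that is, $T_\alpha\neq\emptyset$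 if and only if $\alpha<\kappa$), and $|T_\alpha|<\kappa$ for every $\alpha$. A $\kappa$-tree $(T,<_T)$ with $T\subseteq H_\kappa$ is definable in the very wide sense if both $T$ and $<_T$ are definable over $(H_\kappa,\in)$. A cofinal branch of $T$ is a subset of $T$ that is linearly ordered by $<_T$ and intersects every (nonempty) level of $T$. Lemma 3.3. Let $\kappa$ be a $\Pi^1_1$ reflecting cardinal, and let $T$ be a $\kappa$-tree definable in the very wide sense. Then $T$ has a cofinal branch. -/

import Mathlib

universe u v

open scoped Cardinal

namespace DefinableTree

/-! ### Trees -/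

/-- `(T, lt)` is a tree: a (strictly) partially ordered set in which the predecessors of every
element are well-ordered, and which has a root lying below every other element. -/
structure IsTree {T : Type v} (lt : T → T → Prop) : Prop where
  isStrictOrder : IsStrictOrder T lt
  isWellOrder (t : T) : IsWellOrder {s // lt s t} (Subrel lt fun s => lt s t)
  exists_root : ∃ r, ∀ t, t ≠ r → lt r t

/-- The `o`-th level of `(T, lt)`: the elements whose set of predecessors has order type `o`. -/
def level {T : Type v} (lt : T → T → Prop) (o : Ordinal.{v}) : Set T :=
  {t | Nonempty (Subrel lt (fun s => lt s t) ≃r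
    ((· < ·) : {a : Ordinal.{v} // a < o} → {a : Ordinal.{v} // a < o} → Prop))}

/-- `(T, lt)` is a `κ`-tree: a tree of cardinality `κ` and of height `κ` all of whose levels have
cardinality less than `κ`. -/
structure IsKTree (κ : Cardinal.{v}) {T : Type v} (lt : T → T → Prop) : Prop where
  isTree : IsTree lt
  card_eq : #T = κ
  card_level_lt (o : Ordinal.{v}) : #(level lt o) < κ
  height_eq (o : Ordinal.{v}) : (level lt o).Nonempty ↔ o < κ.ord

/-- A cofinal branch: a linearly ordered subset that meets every (nonempty) level. -/
def IsCofinalBranch {T : Type v} (lt : T → T → Prop) (b : Set T) : Prop :=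
  IsChain lt b ∧ ∀ o : Ordinal.{v}, (level lt o).Nonempty → (b ∩ level lt o).Nonempty

/-! ### The structures `(M, ∈, P₁, P₂, …)` -/

/-- Relation symbols: a binary symbol for membership, and a unary predicate symbol for every
`i : ι`. -/
inductive SetRel (ι : Type) : ℕ → Type
  | mem : SetRel ι 2
  | pred (i : ι) : SetRel ι 1

/-- The first-order language of set theory, with additional unary predicates indexed by `ι`. -/
def setLang (ι : Type) : FirstOrder.Language :=
  ⟨fun _ => Empty, SetRel ι⟩

/-- The structure `(M, ∈, P)`, where `P i` interprets the `i`-th predicate symbol. -/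
@[reducible]
def setStructure {ι : Type} (M : Set ZFSet.{u}) (P : ι → Set M) : (setLang ι).Structure M where
  funMap f _ := f.elim
  RelMap
    | .mem, v => (v 0 : ZFSet) ∈ (v 1 : ZFSet)
    | .pred i, v => v 0 ∈ P i

/-- The pure structure `(M, ∈)`, in the language whose only symbol is membership. -/
@[reducible]
def memStructure (M : Set ZFSet.{u}) : (setLang Empty).Structure M :=
  setStructure M fun i => i.elim

/-- The subset `A` of `M` is first-order definable over `(M, ∈)` with parameters from `M`. -/
def DefinableOver (M : Set ZFSet.{u}) (A : Set M) : Prop :=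
  letI := memStructure M
  Set.Definable₁ Set.univ (setLang Empty) A

/-- The binary relation `R` on `M` is first-order definable over `(M, ∈)` with parameters
from `M`. -/
def DefinableRelOver (M : Set ZFSet.{u}) (R : M → M → Prop) : Prop :=
  letI := memStructure M
  Set.Definable₂ Set.univ (setLang Empty) {p : M × M | R p.1 p.2}

/-! ### `Π¹₁` sentences and `Π¹₁` reflecting cardinals -/

/-- `Π¹₁` sentences `∀ X₁ … ∀ Xₙ φ` about structures `(M, ∈, A)`: the `Xᵢ` are second-order
(set) variables, and `φ` is a first-order sentence in membership, the predicate for `A`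
(with index `none`), and the predicates for the `Xᵢ` (with index `some i`). -/
structure Pi11Sentence where
  numVars : ℕ
  matrix : (setLang (Option (Fin numVars))).Sentence

/-- `(M, ∈, A ∩ M) ⊨ Φ`: the set variables of `Φ` range over all subsets of `M`. -/
def Pi11Sentence.Holds (Φ : Pi11Sentence) (M A : Set ZFSet.{u}) : Prop :=
  ∀ X : Fin Φ.numVars → Set M,
    letI := setStructure M fun i : Option (Fin Φ.numVars) => i.elim {x : M | (x : ZFSet) ∈ A} X
    M ⊨ Φ.matrix

/-- The stage `V_o` of the cumulative hierarchy, as a set of sets. -/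
noncomputable def V (o : Ordinal.{u}) : Set ZFSet.{u} :=
  {x | x ∈ ZFSet.vonNeumann o}

/-- `κ` is `Π¹₁` reflecting: `κ` is (strongly) inaccessible, and whenever `A ⊆ V_κ` is definable
over `V_κ` with parameters, every `Π¹₁` sentence true in `(V_κ, ∈, A)` is true in
`(V_α, ∈, A ∩ V_α)` for some ordinal `α < κ`. -/
structure IsPi11Reflecting (κ : Cardinal.{u}) : Prop where
  isInaccessible : κ.IsInaccessible
  reflect (A : Set ZFSet.{u}) (hA : A ⊆ V κ.ord)
    (hdef : DefinableOver (V κ.ord) {x | (x : ZFSet) ∈ A})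
    (Φ : Pi11Sentence) (hΦ : Φ.Holds (V κ.ord) A) :
    ∃ α < κ.ord, Φ.Holds (V α) (A ∩ V α)

/-! ### Definable trees -/

/-- `H_κ`: the sets whose transitive closure has cardinality less than `κ`, i.e. the subsets of
transitive sets of cardinality less than `κ`. -/
def H (κ : Cardinal.{u}) : Set ZFSet.{u} :=
  {x | ∃ y : ZFSet.{u}, y.IsTransitive ∧ x ⊆ y ∧ y.card < κ}

/-- `(T, lt)`, with `T ⊆ H_κ`, is definable in the very wide sense: both `T` and `lt` are
first-order definable over `(H_κ, ∈)` with parameters. -/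
def DefinableVeryWide (κ : Cardinal.{u}) (T : Set (H κ)) (lt : T → T → Prop) : Prop :=
  DefinableOver (H κ) T ∧
    DefinableRelOver (H κ) fun x y => ∃ (hx : x ∈ T) (hy : y ∈ T), lt ⟨x, hx⟩ ⟨y, hy⟩

end DefinableTree

universe w

namespace DefinableTree

/-! ### Levels of trees -/

section Level

variable {T : Type v} {lt : T → T → Prop}

/-! Inaccessibility gives `H κ = V κ.ord`. Suppose there is no cofinal branch. A single predicate
`A` (`treeCode`) codes the tree: it contains the pairs `{s, t}` with `s ≤ t`, and also closed sets
`z` with at least three elements, a size that keeps the two kinds apart. The reflected sentence says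
that the large members of `A` cover the structure and that every pairwise comparable `X` is
contained in an element.

It holds at `κ`: closed stages `V γ` are cofinal (`exists_closed_stage`), and a chain unbounded in
`V κ.ord` would generate a branch (`exists_isCofinalBranch_of_unbounded`). It fails at each `α <
κ.ord`: take a node `t` outside `V α`. Its predecessors in `V α` form a chain, so they would lie in
some `y ∈ z` with `z` closed, yet `z` contains a predecessor of `t` outside `y`. Closedness refers
to all nodes, even those outside `V α`. Since it is stored in `A` rather than stated by the
sentence, it survives reflection. -/

/-- The order type of the set of predecessors of an element of a tree. -/
noncomputable def IsTree.height (h : IsTree lt) (t : T) : Ordinal.{v} :=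
  letI := h.isWellOrder t
  Ordinal.type (Subrel lt fun s => lt s t)

theorem IsTree.mem_level_iff (h : IsTree lt) {t : T} {o : Ordinal.{v}} :
    t ∈ level lt o ↔ h.height t = o := by
  let := h.isWellOrder t
  -- The ordinals below `o` form a type one universe higher than `T`, so order types are compared
  -- after lifting.
  have key := Ordinal.lift_type_eq.{v, v + 1, v + 1} (r := Subrel lt fun s => lt s t)
    (s := ((· < ·) : {a : Ordinal.{v} // a < o} → {a : Ordinal.{v} // a < o} → Prop))
  have ho : Ordinal.type ((· < ·) : {a : Ordinal.{v} // a < o} → {a : Ordinal.{v} // a < o} → Prop)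
      = Ordinal.lift.{v + 1} o := Ordinal.type_lt_Iio o
  rw [ho] at key
  refine key.symm.trans ?_
  rw [Ordinal.lift_id'.{v + 1, v + 1}, Ordinal.lift_inj]
  rfl

theorem IsTree.trans (h : IsTree lt) {a b c : T} (hab : lt a b) (hbc : lt b c) : lt a c :=
  h.isStrictOrder.toIsTrans.trans _ _ _ hab hbc

theorem IsTree.height_subtype (h : IsTree lt) {t : T} (s : {s // lt s t}) :
    letI := h.isWellOrder t
    Ordinal.typein (Subrel lt fun s => lt s t) s = h.height s := by
  let := h.isWellOrder t
  let := h.isWellOrder s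
  rw [← Ordinal.type_subrel (Subrel lt fun s => lt s t) s]
  refine Quotient.sound ⟨⟨⟨fun x => ⟨x.1.1, x.2⟩, fun x => ⟨⟨x.1, h.trans x.2 s.2⟩, x.2⟩,
    fun _ => rfl, fun _ => rfl⟩, Iff.rfl⟩⟩

theorem IsTree.exists_lt_height_eq (h : IsTree lt) {t : T} {o : Ordinal.{v}}
    (ho : o < h.height t) : ∃ s, lt s t ∧ h.height s = o := by
  let := h.isWellOrder t
  obtain ⟨s, hs⟩ := Ordinal.typein_surj (Subrel lt fun s => lt s t) ho
  exact ⟨s, s.2, (h.height_subtype s).symm.trans hs⟩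

theorem IsTree.comparable (h : IsTree lt) {a b t : T} (ha : lt a t) (hb : lt b t) :
    lt a b ∨ a = b ∨ lt b a := by
  let := h.isWellOrder t
  have := trichotomous_of (Subrel lt fun s => lt s t) ⟨a, ha⟩ ⟨b, hb⟩
  simpa [Subrel] using this

end Level

/-! ### Small subsets of `V_κ` -/

/-- Regularity of `κ`, for index types one universe up, where sets of nodes live; such a type is
small, so the supremum exists. -/
theorem exists_upper_bound_lt_ord {κ : Cardinal.{u}} (hκ : κ.IsRegular) {β : Type (u + 1)}
    (hβ : #β < Cardinal.lift.{u + 1} κ) (f : β → Ordinal.{u}) (hf : ∀ i, f i < κ.ord) :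
    ∃ ε < κ.ord, ∀ i, f i ≤ ε := by
  obtain ⟨c, hc⟩ := Cardinal.mem_range_lift_of_le hβ.le
  have : Small.{u} β := by
    rw [← Cardinal.mk_out c, ← Cardinal.mk_uLift, Cardinal.eq] at hc
    obtain ⟨e⟩ := hc
    exact small_map e.symm
  refine ⟨⨆ i, f i, Ordinal.lift_iSup_lt_of_lt_cof ?_ hf, Ordinal.le_iSup f⟩
  rw [← Ordinal.lift_cof, hκ.cof_ord, Cardinal.lift_id'.{u, u + 1}]
  exact hβ

section Bounded

variable {κ : Cardinal.{u}} {T : Type (u + 1)} {lt : T → T → Prop} {ρ : T → Ordinal.{u}}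

/-- Regularity is used twice: within each level, which has fewer than `κ` nodes, and then across the
fewer than `κ` levels. -/
theorem exists_rank_bound_of_height_lt (hκ : κ.IsRegular)
    (hT : IsKTree (Cardinal.lift.{u + 1} κ) lt) (hρ : ∀ t, ρ t < κ.ord)
    {o : Ordinal.{u + 1}} (ho : o < (Cardinal.lift.{u + 1} κ).ord) :
    ∃ ε < κ.ord, ∀ t, hT.isTree.height t < o → ρ t < ε := by
  have hsucc {ε : Ordinal.{u}} (h : ε < κ.ord) : Order.succ ε < κ.ord :=
    (Cardinal.isSuccLimit_ord hκ.1).succ_lt h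
  obtain ⟨o, rfl⟩ : o ∈ Set.range Ordinal.lift.{u + 1, u} := by
    rw [← Cardinal.lift_ord] at ho
    exact Ordinal.mem_range_lift_of_le ho.le
  rw [← Cardinal.lift_ord, Ordinal.lift_lt] at ho
  have hlev (i : Set.Iio o) : ∃ ε < κ.ord, ∀ t : level lt (Ordinal.lift.{u + 1} i.1), ρ t ≤ ε :=
    exists_upper_bound_lt_ord hκ (hT.card_level_lt _) _ fun t => hρ t
  choose e he he' using hlev
  obtain ⟨ε, hε, hε'⟩ := exists_upper_bound_lt_ord hκ (by
    rw [Cardinal.mk_Iio_ordinal, Cardinal.lift_lt]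
    exact Cardinal.lt_ord.1 ho) e he
  refine ⟨Order.succ ε, hsucc hε, fun t ht => Order.lt_succ_of_le ?_⟩
  obtain ⟨p, hp⟩ := Ordinal.mem_range_lift_of_le ht.le
  have hpo : p < o := by rwa [← hp, Ordinal.lift_lt] at ht
  exact (he' ⟨p, hpo⟩ ⟨t, hT.isTree.mem_level_iff.2 hp.symm⟩).trans (hε' _)

theorem height_lt_ord (hT : IsKTree (Cardinal.lift.{u + 1} κ) lt) (t : T) :
    hT.isTree.height t < (Cardinal.lift.{u + 1} κ).ord :=
  (hT.height_eq _).1 ⟨t, hT.isTree.mem_level_iff.2 rfl⟩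

theorem exists_height_bound_of_rank_lt (hκ : κ.IsRegular)
    (hT : IsKTree (Cardinal.lift.{u + 1} κ) lt)
    (hcard : ∀ δ < κ.ord, #{t // ρ t < δ} < Cardinal.lift.{u + 1} κ)
    {δ : Ordinal.{u}} (hδ : δ < κ.ord) :
    ∃ o < (Cardinal.lift.{u + 1} κ).ord, ∀ t, ρ t < δ → hT.isTree.height t ≤ o := by
  refine ⟨⨆ t : {t // ρ t < δ}, hT.isTree.height t, ?_, fun t ht =>
    Ordinal.le_iSup (fun t : {t // ρ t < δ} => hT.isTree.height t) ⟨t, ht⟩⟩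
  refine Ordinal.iSup_lt_of_lt_cof ?_ fun t => height_lt_ord hT t
  rw [← Cardinal.lift_ord, ← Ordinal.lift_cof, hκ.cof_ord]
  exact hcard δ hδ

/-- There are arbitrarily large `γ < κ` such that, for `δ < γ`, every node outside `V_γ` has a
predecessor in `V_γ` outside `V_δ`. -/
theorem exists_closed_stage (hκ : κ.IsInaccessible)
    (hT : IsKTree (Cardinal.lift.{u + 1} κ) lt) (hρ : ∀ t, ρ t < κ.ord)
    (hcard : ∀ δ < κ.ord, #{t // ρ t < δ} < Cardinal.lift.{u + 1} κ)
    {δ₀ : Ordinal.{u}} (hδ₀ : δ₀ < κ.ord) :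
    ∃ γ < κ.ord, δ₀ ≤ γ ∧
      ∀ δ < γ, ∀ t, γ ≤ ρ t → ∃ s, lt s t ∧ δ ≤ ρ s ∧ ρ s < γ := by
  have step (δ : Ordinal.{u}) : ∃ ε, (δ < κ.ord → ε < κ.ord) ∧
      (δ < κ.ord → ∀ t, ε ≤ ρ t → ∃ s, lt s t ∧ δ ≤ ρ s ∧ ρ s < ε) := by
    by_cases hδ : δ < κ.ord
    · obtain ⟨o, ho, ho'⟩ := exists_height_bound_of_rank_lt hκ.isRegular hT hcard hδ
      have ho₁ : Order.succ o < (Cardinal.lift.{u + 1} κ).ord :=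
        (Cardinal.isSuccLimit_ord (by simpa using hκ.1.le)).succ_lt ho
      have ho₂ : Order.succ (Order.succ o) < (Cardinal.lift.{u + 1} κ).ord :=
        (Cardinal.isSuccLimit_ord (by simpa using hκ.1.le)).succ_lt ho₁
      -- Heights in `V δ` are at most `o`, so a predecessor at height `o + 1` avoids `V δ`; bounding
      -- ranks below height `o + 2` places it in `V ε`.
      obtain ⟨ε, hε, hε'⟩ := exists_rank_bound_of_height_lt hκ.isRegular hT hρ ho₂
      refine ⟨ε, fun _ => hε, fun _ t ht => ?_⟩
      have : Order.succ o < hT.isTree.height t := by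
        by_contra! h
        exact ht.not_gt (hε' t (Order.lt_succ_of_le h))
      obtain ⟨s, hst, hs⟩ := hT.isTree.exists_lt_height_eq this
      refine ⟨s, hst, ?_, hε' s (hs ▸ Order.lt_succ _)⟩
      by_contra! h
      exact (ho' s h).not_gt (hs ▸ Order.lt_succ _)
    · exact ⟨0, fun h => absurd h hδ, fun h => absurd h hδ⟩
  choose g hg hg' using step
  have hcof : ℵ₀ < κ.ord.cof := by rw [hκ.isRegular.cof_ord]; exact hκ.1
  -- Iterating `g` countably often stays below `κ.ord` by uncountable cofinality, and every `δ < γ`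
  -- lies below some iterate.
  refine ⟨Ordinal.nfp g δ₀, Ordinal.nfp_lt_ord hcof (fun i hi => hg i hi) hδ₀,
    Ordinal.le_nfp _ _, fun δ hδ t ht => ?_⟩
  obtain ⟨n, hn⟩ := Ordinal.lt_nfp_iff.1 hδ
  have hlt : g^[n] δ₀ < κ.ord := by
    clear hn
    induction n with
    | zero => exact hδ₀
    | succ n ih => rw [Function.iterate_succ_apply']; exact hg _ ih
  have hle : g (g^[n] δ₀) ≤ Ordinal.nfp g δ₀ := by
    rw [← Function.iterate_succ_apply' g]
    exact Ordinal.iterate_le_nfp g δ₀ (n + 1)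
  obtain ⟨s, hst, h₁, h₂⟩ := hg' _ hlt t (hle.trans ht)
  exact ⟨s, hst, hn.le.trans h₁, h₂.trans_le hle⟩

/-- A chain that is unbounded in `V_κ` generates a cofinal branch. -/
theorem exists_isCofinalBranch_of_unbounded (hκ : κ.IsRegular)
    (hT : IsKTree (Cardinal.lift.{u + 1} κ) lt) (hρ : ∀ t, ρ t < κ.ord) {X : Set T}
    (hX : ∀ x ∈ X, ∀ y ∈ X, lt x y ∨ x = y ∨ lt y x) (hub : ∀ ε < κ.ord, ∃ x ∈ X, ε ≤ ρ x) :
    ∃ b : Set T, IsCofinalBranch lt b := by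
  have h := hT.isTree
  refine ⟨{s | ∃ x ∈ X, s = x ∨ lt s x}, ?_, fun o ho => ?_⟩
  · have main {a b x y : T} (ha : a = x ∨ lt a x) (hb : b = y ∨ lt b y) (hxy : lt x y ∨ x = y) :
        lt a b ∨ a = b ∨ lt b a := by
      -- Both elements now lie weakly below the same node `y`, where the order is linear.
      have ha' : a = y ∨ lt a y := by
        rcases ha with rfl | ha <;> rcases hxy with hxy | rfl
        · exact .inr hxy
        · exact .inl rfl
        · exact .inr (h.trans ha hxy)
        · exact .inr ha
      rcases ha' with rfl | ha' <;> rcases hb with rfl | hb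
      · exact .inr (.inl rfl)
      · exact .inr (.inr hb)
      · exact .inl ha'
      · exact h.comparable ha' hb
    rintro a ⟨x, hx, ha⟩ b ⟨y, hy, hb⟩ hab
    rcases hX x hx y hy with hxy | hxy | hxy
    · have := main ha hb (.inl hxy); tauto
    · have := main ha hb (.inr hxy); tauto
    · have := main hb ha (.inl hxy); have := hab.symm; tauto
  · rw [hT.height_eq] at ho
    obtain ⟨ε, hε, hε'⟩ := exists_rank_bound_of_height_lt hκ hT hρ ho
    obtain ⟨x, hx, hxε⟩ := hub ε hε
    have hox : o ≤ hT.isTree.height x := by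
      by_contra! hlt
      exact hxε.not_gt (hε' x hlt)
    rcases hox.eq_or_lt with rfl | hlt
    · exact ⟨x, ⟨x, hx, .inl rfl⟩, h.mem_level_iff.2 rfl⟩
    · obtain ⟨s, hs, hs'⟩ := h.exists_lt_height_eq hlt
      exact ⟨s, ⟨x, hx, .inr hs⟩, h.mem_level_iff.2 hs'⟩

end Bounded

/-! ### The stages of the cumulative hierarchy below an inaccessible cardinal -/

theorem mem_V_iff {o : Ordinal.{u}} {x : ZFSet.{u}} : x ∈ V o ↔ x.rank < o :=
  ZFSet.mem_vonNeumann

theorem card_vonNeumann_lt {κ : Cardinal.{u}} (hκ : κ.IsInaccessible) {δ : Ordinal.{u}}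
    (hδ : δ < κ.ord) : (ZFSet.vonNeumann δ).card < κ := by
  rw [ZFSet.card_vonNeumann]
  calc Cardinal.preBeth δ < Cardinal.preBeth κ.ord := Cardinal.preBeth_strictMono hδ
    _ = κ := hκ.preBeth_ord

/-- A transitive set has elements of every rank below its own; choosing one per rank gives an
injection. -/
theorem card_rank_le_card {y : ZFSet.{u}} (hy : y.IsTransitive) : y.rank.card ≤ y.card := by
  have hsurj : ∀ o : Set.Iio y.rank, ∃ x : (y : Set ZFSet.{u}), x.1.rank = o := by
    have aux (x : ZFSet.{u}) : x ⊆ y → ∀ o < x.rank, ∃ z ∈ y, z.rank = o := by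
      induction x using ZFSet.inductionOn with
      | _ x ih =>
        intro hx o ho
        obtain ⟨z, hz, hoz⟩ := ZFSet.lt_rank_iff.1 ho
        rcases hoz.eq_or_lt with rfl | hlt
        · exact ⟨z, hx hz, rfl⟩
        · exact ih z hz (hy z (hx hz)) o hlt
    rintro ⟨o, ho⟩
    obtain ⟨z, hz, hzo⟩ := aux y (fun _ h => h) o ho
    exact ⟨⟨z, hz⟩, hzo⟩
  choose f hf using hsurj
  have := Cardinal.mk_le_of_injective (f := f) fun a b hab => by
    ext; rw [← hf a, ← hf b, hab]
  rw [Cardinal.mk_Iio_ordinal] at this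
  exact Cardinal.lift_le.1 (this.trans_eq ZFSet.cardinalMk_coe_sort)

theorem H_eq_V {κ : Cardinal.{u}} (hκ : κ.IsInaccessible) : H κ = V κ.ord := by
  ext x
  rw [mem_V_iff]
  constructor
  · rintro ⟨y, hy, hxy, hcard⟩
    exact (ZFSet.rank_mono hxy).trans_lt (Cardinal.lt_ord.2 ((card_rank_le_card hy).trans_lt hcard))
  · intro hx
    exact ⟨_, ZFSet.isTransitive_vonNeumann _, ZFSet.subset_vonNeumann_self x,
      card_vonNeumann_lt hκ hx⟩

theorem card_rank_lt {κ : Cardinal.{u}} (hκ : κ.IsInaccessible) {M : Set ZFSet.{u}} (T : Set M)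
    {δ : Ordinal.{u}} (hδ : δ < κ.ord) :
    #{t : T // t.1.1.rank < δ} < Cardinal.lift.{u + 1} κ := by
  refine lt_of_le_of_lt ?_ (Cardinal.lift_lt.2 (card_vonNeumann_lt hκ hδ))
  rw [← ZFSet.cardinalMk_coe_sort]
  refine Cardinal.mk_le_of_injective (f := fun t => ⟨t.1.1.1, ZFSet.mem_vonNeumann.2 t.2⟩) ?_
  intro a b hab
  exact Subtype.ext (Subtype.ext (Subtype.ext (congrArg (fun z => z.1) hab)))

/-! ### Formulas with named variables -/

section Formula

open FirstOrder FirstOrder.Language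

variable {L : FirstOrder.Language.{v, w}}

/-- Existential quantification over the variable `k`. -/
noncomputable def exVar (k : ℕ) (φ : L.Formula ℕ) : L.Formula ℕ :=
  (BoundedFormula.relabel (n := 1) (k := 0)
    (fun i => if i = k then Sum.inr 0 else Sum.inl i : ℕ → ℕ ⊕ Fin 1) φ).ex

/-- Universal quantification over the variable `k`. -/
noncomputable def allVar (k : ℕ) (φ : L.Formula ℕ) : L.Formula ℕ :=
  (BoundedFormula.relabel (n := 1) (k := 0)
    (fun i => if i = k then Sum.inr 0 else Sum.inl i : ℕ → ℕ ⊕ Fin 1) φ).all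

/-- Equality of two variables. -/
def eqVar (i j : ℕ) : L.Formula ℕ := (Term.var i).equal (Term.var j)

/-- A unary relation applied to a variable. -/
def relVar (R : L.Relations 1) (i : ℕ) : L.Formula ℕ := R.formula₁ (Term.var i)

/-- A binary relation applied to two variables. -/
def relVar₂ (R : L.Relations 2) (i j : ℕ) : L.Formula ℕ := R.formula₂ (Term.var i) (Term.var j)

variable {M : Type u} [L.Structure M] {v : ℕ → M}

theorem realize_quantified_var (k : ℕ) (φ : L.Formula ℕ) (x : M) :
    (BoundedFormula.relabel (n := 1) (k := 0)
      (fun i => if i = k then Sum.inr 0 else Sum.inl i : ℕ → ℕ ⊕ Fin 1) φ).Realize v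
        (Fin.snoc default x) ↔ φ.Realize (Function.update v k x) := by
  rw [BoundedFormula.realize_relabel, Formula.Realize]
  have h₁ : (Sum.elim v ((Fin.snoc default x : Fin 1 → M) ∘ Fin.castAdd 0) ∘
      fun i => if i = k then Sum.inr 0 else Sum.inl i) = Function.update v k x := by
    funext i
    by_cases hi : i = k
    · subst hi; simp [Fin.snoc]
    · simp [hi]
  rw [h₁]
  exact iff_of_eq (congrArg _ (Subsingleton.elim _ _))

@[simp]
theorem realize_exVar {k : ℕ} {φ : L.Formula ℕ} :
    (exVar k φ).Realize v ↔ ∃ x : M, φ.Realize (Function.update v k x) :=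
  BoundedFormula.realize_ex.trans (exists_congr fun x => realize_quantified_var k φ x)

@[simp]
theorem realize_allVar {k : ℕ} {φ : L.Formula ℕ} :
    (allVar k φ).Realize v ↔ ∀ x : M, φ.Realize (Function.update v k x) :=
  BoundedFormula.realize_all.trans (forall_congr' fun x => realize_quantified_var k φ x)

@[simp]
theorem realize_eqVar {i j : ℕ} : (eqVar i j : L.Formula ℕ).Realize v ↔ v i = v j :=
  Formula.realize_equal

@[simp]
theorem realize_relVar {R : L.Relations 1} {i : ℕ} :
    (relVar R i).Realize v ↔ Structure.RelMap R ![v i] :=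
  Formula.realize_rel₁

@[simp]
theorem realize_relVar₂ {R : L.Relations 2} {i j : ℕ} :
    (relVar₂ R i j).Realize v ↔ Structure.RelMap R ![v i, v j] :=
  Formula.realize_rel₂

@[simp]
theorem realize_inf_formula {φ ψ : L.Formula ℕ} :
    Formula.Realize (φ ⊓ ψ) v ↔ φ.Realize v ∧ ψ.Realize v :=
  BoundedFormula.realize_inf

@[simp]
theorem realize_sup_formula {φ ψ : L.Formula ℕ} :
    Formula.Realize (φ ⊔ ψ) v ↔ φ.Realize v ∨ ψ.Realize v :=
  BoundedFormula.realize_sup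

@[simp]
theorem realize_imp_formula {φ ψ : L.Formula ℕ} :
    Formula.Realize (φ.imp ψ) v ↔ (φ.Realize v → ψ.Realize v) :=
  BoundedFormula.realize_imp

/-- A sentence asserting that `φ` holds when all its variables take some common value. -/
noncomputable def exSentence (φ : L.Formula ℕ) : L.Sentence :=
  (BoundedFormula.relabel (n := 1) (k := 0) (fun _ => Sum.inr 0 : ℕ → Empty ⊕ Fin 1) φ).ex

/-- For a formula with no free variables the common value is a dummy, and the only extra content is
nonemptiness of `M`. -/
theorem realize_exSentence {φ : L.Formula ℕ} :
    M ⊨ exSentence φ ↔ ∃ x : M, φ.Realize fun _ => x := by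
  refine BoundedFormula.realize_ex.trans (exists_congr fun x => ?_)
  rw [BoundedFormula.realize_relabel, Formula.Realize]
  have h₁ : (Sum.elim (default : Empty → M) ((Fin.snoc default x : Fin 1 → M) ∘ Fin.castAdd 0) ∘
      fun _ : ℕ => Sum.inr 0) = fun _ => x := by
    funext i; simp [Fin.snoc]
  rw [h₁]
  exact iff_of_eq (congrArg _ (Subsingleton.elim _ _))

/-- The variable `a` has at least three elements (with respect to `E`). -/
noncomputable def threeElems (E : L.Relations 2) (a : ℕ) : L.Formula ℕ :=
  exVar 10 (exVar 11 (exVar 12 (relVar₂ E 10 a ⊓ (relVar₂ E 11 a ⊓ (relVar₂ E 12 a ⊓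
    ((eqVar 10 11).not ⊓ ((eqVar 10 12).not ⊓ (eqVar 11 12).not)))))))

/-- The variable `a` is the unordered pair of `s` and `t` (with respect to `E`). -/
noncomputable def isPair (E : L.Relations 2) (a s t : ℕ) : L.Formula ℕ :=
  allVar 10 ((relVar₂ E 10 a).iff (eqVar 10 s ⊔ eqVar 10 t))

/-- The bound `a < 10` prevents capture by the quantified variables 10, 11 and 12. -/
theorem realize_threeElems {E : L.Relations 2} {a : ℕ} (ha : a < 10) :
    (threeElems E a).Realize v ↔ ∃ x y z : M, Structure.RelMap E ![x, v a] ∧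
      Structure.RelMap E ![y, v a] ∧ Structure.RelMap E ![z, v a] ∧ x ≠ y ∧ x ≠ z ∧ y ≠ z := by
  have h₀ : a ≠ 10 := by omega
  have h₁ : a ≠ 11 := by omega
  have h₂ : a ≠ 12 := by omega
  simp [threeElems, h₀, h₁, h₂, Formula.realize_not]

theorem realize_isPair {E : L.Relations 2} {a s t : ℕ} (ha : a < 10) (hs : s < 10) (ht : t < 10) :
    (isPair E a s t).Realize v ↔ ∀ x : M, Structure.RelMap E ![x, v a] ↔ x = v s ∨ x = v t := by
  simp [isPair, ha.ne, hs.ne, ht.ne, Formula.realize_iff]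

end Formula

/-! ### The code of a tree -/

/-- `z` has at least three elements. -/
def HasThree (z : ZFSet.{u}) : Prop :=
  ∃ a ∈ z, ∃ b ∈ z, ∃ c ∈ z, a ≠ b ∧ a ≠ c ∧ b ≠ c

theorem not_hasThree_pair (a b : ZFSet.{u}) : ¬ HasThree ({a, b} : ZFSet.{u}) := by
  rintro ⟨x, hx, y, hy, z, hz, h⟩
  simp only [ZFSet.mem_pair] at hx hy hz
  grind

/-- The union of the set of all pairs `{s, t}` with `s ≤ t` in the tree, and of the set of all `z`
with at least three elements such that, for `y ∈ z`, every node outside `z` has a predecessor in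
`z` outside `y`. -/
def treeCode {M : Set ZFSet.{u}} (T : Set M) (R : M → M → Prop) : Set ZFSet.{u} :=
  {a | a ∈ M ∧ ((∃ s ∈ T, ∃ t ∈ T, (s = t ∨ R s t) ∧ a = {s.1, t.1}) ∨
    (HasThree a ∧ ∀ y : M, y.1 ∈ a → ∀ t ∈ T, t.1 ∉ a → ∃ s : M, s.1 ∈ a ∧ R s t ∧ s.1 ∉ y.1))}

section Code

open FirstOrder FirstOrder.Language

theorem hasThree_iff {M : Set ZFSet.{u}} (hM : ∀ x ∈ M, ∀ y ∈ x, y ∈ M) (a : M) :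
    HasThree a.1 ↔ ∃ x y z : M, x.1 ∈ a.1 ∧ y.1 ∈ a.1 ∧ z.1 ∈ a.1 ∧ x ≠ y ∧ x ≠ z ∧ y ≠ z := by
  constructor
  · rintro ⟨x, hx, y, hy, z, hz, h₁, h₂, h₃⟩
    exact ⟨⟨x, hM _ a.2 _ hx⟩, ⟨y, hM _ a.2 _ hy⟩, ⟨z, hM _ a.2 _ hz⟩, hx, hy, hz,
      fun h => h₁ (congrArg Subtype.val h), fun h => h₂ (congrArg Subtype.val h),
      fun h => h₃ (congrArg Subtype.val h)⟩
  · rintro ⟨x, y, z, hx, hy, hz, h₁, h₂, h₃⟩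
    exact ⟨x, hx, y, hy, z, hz, Subtype.coe_ne_coe.2 h₁, Subtype.coe_ne_coe.2 h₂,
      Subtype.coe_ne_coe.2 h₃⟩

theorem eq_pair_iff {M : Set ZFSet.{u}} (hM : ∀ x ∈ M, ∀ y ∈ x, y ∈ M) (a s t : M) :
    a.1 = {s.1, t.1} ↔ ∀ x : M, x.1 ∈ a.1 ↔ x = s ∨ x = t := by
  constructor
  · intro h x
    rw [h, ZFSet.mem_pair, Subtype.ext_iff, Subtype.ext_iff]
  · intro h
    ext x
    rw [ZFSet.mem_pair]
    constructor
    · intro hx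
      have := (h ⟨x, hM _ a.2 _ hx⟩).1 hx
      simpa [Subtype.ext_iff] using this
    · rintro (rfl | rfl)
      · exact (h s).2 (.inl rfl)
      · exact (h t).2 (.inr rfl)

/-- The formula defining `treeCode`, given formulas for the nodes and for the tree order. -/
noncomputable def treeCodeFormula {L : FirstOrder.Language.{v, w}} (E : L.Relations 2)
    (φ : L.Formula (Fin 1)) (ψ : L.Formula (Fin 2)) : L.Formula ℕ :=
  (exVar 1 (φ.relabel (fun _ => 1) ⊓ exVar 2 (φ.relabel (fun _ => 2) ⊓
    ((eqVar 1 2 ⊔ ψ.relabel ![1, 2]) ⊓ isPair E 0 1 2)))) ⊔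
  (threeElems E 0 ⊓ allVar 1 ((relVar₂ E 1 0).imp (allVar 2 ((φ.relabel fun _ => 2).imp
    ((relVar₂ E 2 0).not.imp
      (exVar 3 (relVar₂ E 3 0 ⊓ (ψ.relabel ![3, 2] ⊓ (relVar₂ E 3 1).not))))))))

theorem realize_treeCodeFormula {L : FirstOrder.Language.{v, w}} {M : Set ZFSet.{u}}
    [L.Structure M] (hM : ∀ x ∈ M, ∀ y ∈ x, y ∈ M) {E : L.Relations 2}
    (hE : ∀ x y : M, Structure.RelMap E ![x, y] ↔ x.1 ∈ y.1) {φ : L.Formula (Fin 1)}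
    {ψ : L.Formula (Fin 2)} {T : Set M} {R : M → M → Prop} (hφ : ∀ v, φ.Realize v ↔ v 0 ∈ T)
    (hψ : ∀ v, ψ.Realize v ↔ R (v 0) (v 1)) {v : ℕ → M} :
    (treeCodeFormula E φ ψ).Realize v ↔ (v 0).1 ∈ treeCode T R := by
  have h₀ : (v 0).1 ∈ treeCode T R ↔ ((∃ s ∈ T, ∃ t ∈ T, (s = t ∨ R s t) ∧ (v 0).1 = {s.1, t.1}) ∨
    (HasThree (v 0).1 ∧ ∀ y : M, y.1 ∈ (v 0).1 → ∀ t ∈ T, t.1 ∉ (v 0).1 →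
      ∃ s : M, s.1 ∈ (v 0).1 ∧ R s t ∧ s.1 ∉ y.1)) := and_iff_right (v 0).2
  rw [h₀]
  simp only [treeCodeFormula, realize_sup_formula, realize_exVar, realize_inf_formula,
    realize_eqVar, realize_allVar, realize_imp_formula, Formula.realize_not, realize_relVar₂, hE,
    Formula.realize_relabel, hφ, hψ, realize_threeElems (show 0 < 10 by norm_num),
    realize_isPair (show 0 < 10 by norm_num) (show 1 < 10 by norm_num) (show 2 < 10 by norm_num),
    hasThree_iff hM, eq_pair_iff hM, Function.comp_apply]
  rfl

theorem definableOver_treeCode {M : Set ZFSet.{u}} (hM : ∀ x ∈ M, ∀ y ∈ x, y ∈ M) {T : Set M}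
    {R : M → M → Prop} (hT : DefinableOver M T) (hR : DefinableRelOver M R) :
    DefinableOver M {x | (x : ZFSet) ∈ treeCode T R} := by
  let := memStructure M
  obtain ⟨φ, hφ⟩ := hT
  obtain ⟨ψ, hψ⟩ := hR
  have hφ' (v : Fin 1 → M) : φ.Realize v ↔ v 0 ∈ T :=
    (iff_of_eq (congrArg (v ∈ ·) hφ)).symm
  have hψ' (v : Fin 2 → M) : ψ.Realize v ↔ R (v 0) (v 1) :=
    (iff_of_eq (congrArg (v ∈ ·) hψ)).symm
  let E : (setLang Empty)[[(Set.univ : Set M)]].Relations 2 := Sum.inl SetRel.mem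
  have hE (x y : M) : Structure.RelMap E ![x, y] ↔ x.1 ∈ y.1 := Iff.rfl
  refine ⟨(treeCodeFormula E φ ψ).relabel fun _ => 0, ?_⟩
  ext v
  exact ((Formula.realize_relabel (v := v) (g := fun _ : ℕ => (0 : Fin 1))).trans
    (realize_treeCodeFormula hM hE hφ' hψ')).symm

end Code

/-! ### The reflected sentence -/

section Sentence

open FirstOrder FirstOrder.Language

/-- Every set belongs to a member of `A` with at least three elements, and every set `X` whose
unordered pairs all belong to `A` is contained in some element of the structure. -/
noncomputable def boundedChainsFormula {L : FirstOrder.Language.{v, w}} (E : L.Relations 2)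
    (A X : L.Relations 1) : L.Formula ℕ :=
  allVar 0 (exVar 1 (relVar₂ E 0 1 ⊓ (relVar A 1 ⊓ threeElems E 1))) ⊓
    ((allVar 0 ((relVar X 0).imp (allVar 1 ((relVar X 1).imp
      (exVar 2 (relVar A 2 ⊓ isPair E 2 0 1)))))).imp
        (exVar 0 (allVar 1 ((relVar X 1).imp (relVar₂ E 1 0)))))

theorem realize_boundedChainsFormula {L : FirstOrder.Language.{v, w}} {M A : Set ZFSet.{u}}
    [L.Structure M] (hM : ∀ x ∈ M, ∀ y ∈ x, y ∈ M) {E : L.Relations 2} {P Q : L.Relations 1}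
    {X : Set M} (hE : ∀ x y : M, Structure.RelMap E ![x, y] ↔ x.1 ∈ y.1)
    (hP : ∀ x : M, Structure.RelMap P ![x] ↔ x.1 ∈ A)
    (hQ : ∀ x : M, Structure.RelMap Q ![x] ↔ x ∈ X) {v : ℕ → M} :
    (boundedChainsFormula E P Q).Realize v ↔
      (∀ y : M, ∃ z : M, y.1 ∈ z.1 ∧ z.1 ∈ A ∧ HasThree z.1) ∧
      ((∀ x ∈ X, ∀ y ∈ X, ∃ p : M, p.1 ∈ A ∧ p.1 = {x.1, y.1}) →
        ∃ y : M, ∀ x ∈ X, x.1 ∈ y.1) := by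
  simp only [boundedChainsFormula, realize_exVar, realize_inf_formula, realize_allVar,
    realize_imp_formula, realize_relVar, realize_relVar₂, hE, hP, hQ,
    realize_threeElems (show 1 < 10 by norm_num),
    realize_isPair (show 2 < 10 by norm_num) (show 0 < 10 by norm_num) (show 1 < 10 by norm_num),
    hasThree_iff hM, eq_pair_iff hM]
  rfl

/-- `boundedChainsFormula` as a sentence about `(M, ∈, A, X)`. -/
noncomputable def boundedChainsMatrix : (setLang (Option (Fin 1))).Sentence :=
  exSentence (boundedChainsFormula (SetRel.mem : SetRel _ 2) (SetRel.pred none)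
    (SetRel.pred (some 0)))

/-- The `Π¹₁` sentence obtained from `boundedChainsMatrix` by quantifying over `X`. -/
noncomputable def boundedChains : Pi11Sentence := ⟨1, boundedChainsMatrix⟩

theorem boundedChains_holds_iff {M A : Set ZFSet.{u}} (hM : ∀ x ∈ M, ∀ y ∈ x, y ∈ M) :
    boundedChains.Holds M A ↔ ∀ X : Set M, Nonempty M ∧
      (∀ y : M, ∃ z : M, y.1 ∈ z.1 ∧ z.1 ∈ A ∧ HasThree z.1) ∧
      ((∀ x ∈ X, ∀ y ∈ X, ∃ p : M, p.1 ∈ A ∧ p.1 = {x.1, y.1}) →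
        ∃ y : M, ∀ x ∈ X, x.1 ∈ y.1) := by
  have key (X : Fin 1 → Set M) :
      letI := setStructure M fun i : Option (Fin 1) => i.elim {x : M | (x : ZFSet) ∈ A} X
      Sentence.Realize M boundedChainsMatrix ↔ Nonempty M ∧
        (∀ y : M, ∃ z : M, y.1 ∈ z.1 ∧ z.1 ∈ A ∧ HasThree z.1) ∧
        ((∀ x ∈ X 0, ∀ y ∈ X 0, ∃ p : M, p.1 ∈ A ∧ p.1 = {x.1, y.1}) →
          ∃ y : M, ∀ x ∈ X 0, x.1 ∈ y.1) := by
    let := setStructure M fun i : Option (Fin 1) => i.elim {x : M | (x : ZFSet) ∈ A} X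
    refine realize_exSentence.trans ?_
    rw [← exists_const_iff]
    exact exists_congr fun x => realize_boundedChainsFormula hM (fun _ _ => Iff.rfl)
      (fun _ => Iff.rfl) fun _ => Iff.rfl
  exact ⟨fun h X => (key fun _ => X).1 (h fun _ => X), fun h X => (key X).2 (h (X (0 : Fin 1)))⟩

end Sentence

/-! ### Truth of the sentence at `κ` and its failure below -/

theorem mem_of_mem_V {o : Ordinal.{u}} : ∀ x ∈ V o, ∀ y ∈ x, y ∈ V o := fun _ hx _ hy =>
  mem_V_iff.2 ((ZFSet.rank_lt_of_mem hy).trans (mem_V_iff.1 hx))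

theorem hasThree_vonNeumann {γ : Ordinal.{u}} (hγ : 3 ≤ γ) : HasThree (ZFSet.vonNeumann γ) := by
  have h {a : Ordinal.{u}} (ha : a < 3) : ZFSet.vonNeumann a ∈ ZFSet.vonNeumann γ :=
    ZFSet.vonNeumann_mem_of_lt (ha.trans_le hγ)
  exact ⟨_, h (a := 0) (by norm_num), _, h (a := 1) (by norm_num), _, h (a := 2) (by norm_num),
    ZFSet.vonNeumann_injective.ne (by norm_num), ZFSet.vonNeumann_injective.ne (by norm_num),
    ZFSet.vonNeumann_injective.ne (by norm_num)⟩

variable {κ : Cardinal.{u}} {T : Set (V κ.ord)} {lt : T → T → Prop}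

/-- The tree order as a relation on `V_κ`. -/
def extendRel (lt : T → T → Prop) (x y : V κ.ord) : Prop :=
  ∃ (hx : x ∈ T) (hy : y ∈ T), lt ⟨x, hx⟩ ⟨y, hy⟩

theorem exists_code_mem (hκ : κ.IsInaccessible) (hT : IsKTree (Cardinal.lift.{u + 1} κ) lt)
    (y : V κ.ord) :
    ∃ z : V κ.ord, y.1 ∈ z.1 ∧ z.1 ∈ treeCode T (extendRel lt) ∧ HasThree z.1 := by
  have hlim := Cardinal.isSuccLimit_ord hκ.1.le
  have hω : (3 : Ordinal.{u}) < κ.ord := by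
    have := Cardinal.lt_ord.2 (show (3 : Ordinal.{u}).card < κ by simpa using hκ.nat_lt 3)
    exact this
  obtain ⟨γ, hγ, hγ₀, hcl⟩ := exists_closed_stage (ρ := fun t : T => t.1.1.rank)
    -- The 3 gives `V γ` three elements; the successor puts `y` in it.
    (δ₀ := max 3 (Order.succ y.1.rank)) hκ hT (fun t => mem_V_iff.1 t.1.2)
    (fun δ hδ => card_rank_lt hκ T hδ)
    (max_lt hω (hlim.succ_lt (mem_V_iff.1 y.2)))
  have hz : ZFSet.vonNeumann γ ∈ V κ.ord := ZFSet.vonNeumann_mem_of_lt hγ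
  have h₃ := hasThree_vonNeumann ((le_max_left _ _).trans hγ₀)
  refine ⟨⟨_, hz⟩, ?_, ⟨hz, .inr ⟨h₃, fun x hx t ht hxt => ?_⟩⟩, h₃⟩
  · exact ZFSet.mem_vonNeumann.2 (Order.succ_le_iff.1 ((le_max_right _ _).trans hγ₀))
  · obtain ⟨s, hst, hs, hs'⟩ := hcl _ (ZFSet.mem_vonNeumann.1 hx) ⟨t, ht⟩
      (not_lt.1 fun h => hxt (ZFSet.mem_vonNeumann.2 h))
    exact ⟨s.1, ZFSet.mem_vonNeumann.2 hs', ⟨s.2, ht, hst⟩, fun h =>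
      (ZFSet.rank_lt_of_mem h).not_ge hs⟩

theorem pair_mem_treeCode {s t : T} (h : s = t ∨ lt s t) (hp : {s.1.1, t.1.1} ∈ V κ.ord) :
    {s.1.1, t.1.1} ∈ treeCode T (extendRel lt) :=
  ⟨hp, .inl ⟨s, s.2, t, t.2, h.imp (congrArg Subtype.val) fun h => ⟨s.2, t.2, h⟩, rfl⟩⟩

theorem comparable_of_pair_mem_treeCode {x y : V κ.ord}
    (h : {x.1, y.1} ∈ treeCode T (extendRel lt)) :
    ∃ (hx : x ∈ T) (hy : y ∈ T),
      lt ⟨x, hx⟩ ⟨y, hy⟩ ∨ (⟨x, hx⟩ : T) = ⟨y, hy⟩ ∨ lt ⟨y, hy⟩ ⟨x, hx⟩ := by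
  obtain ⟨-, ⟨s, hs, t, ht, hst, he⟩ | ⟨h₃, -⟩⟩ := h
  · have hcases : x = s ∧ y = t ∨ x = t ∧ y = s := by
      have h (w : ZFSet.{u}) : w = x.1 ∨ w = y.1 ↔ w = s.1 ∨ w = t.1 := by
        rw [← ZFSet.mem_pair, he, ZFSet.mem_pair]
      have h₁ := (h _).1 (.inl rfl)
      have h₂ := (h _).1 (.inr rfl)
      have h₃ := (h _).2 (.inl rfl)
      have h₄ := (h _).2 (.inr rfl)
      simp only [← Subtype.ext_iff] at h₁ h₂ h₃ h₄
      grind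
    rcases hcases with ⟨rfl, rfl⟩ | ⟨rfl, rfl⟩
    · refine ⟨hs, ht, ?_⟩
      rcases hst with h | ⟨_, _, h⟩
      · exact .inr (.inl (Subtype.ext h))
      · exact .inl h
    · refine ⟨ht, hs, ?_⟩
      rcases hst with h | ⟨_, _, h⟩
      · exact .inr (.inl (Subtype.ext h.symm))
      · exact .inr (.inr h)
  · exact absurd h₃ (not_hasThree_pair _ _)

theorem boundedChains_holds_of_not_exists_branch (hκ : κ.IsInaccessible)
    (hT : IsKTree (Cardinal.lift.{u + 1} κ) lt) (hb : ¬ ∃ b : Set T, IsCofinalBranch lt b) :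
    boundedChains.Holds (V κ.ord) (treeCode T (extendRel lt)) := by
  rw [boundedChains_holds_iff mem_of_mem_V]
  refine fun X => ⟨⟨∅, mem_V_iff.2 ?_⟩, exists_code_mem hκ hT, fun hX => ?_⟩
  · rw [ZFSet.rank_empty]
    exact Cardinal.lt_ord.2 (by simpa using hκ.pos)
  have hX' : ∀ x ∈ X, ∀ y ∈ X, {x.1, y.1} ∈ treeCode T (extendRel lt) := by
    intro x hx y hy
    obtain ⟨p, hp, he⟩ := hX x hx y hy
    exact he ▸ hp
  by_contra! hub
  refine hb (exists_isCofinalBranch_of_unbounded (ρ := fun t : T => t.1.1.rank)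
    (X := {t : T | t.1 ∈ X}) hκ.isRegular hT (fun t => mem_V_iff.1 t.1.2)
    (fun x hx y hy => ?_) fun ε hε => ?_)
  · obtain ⟨_, _, h⟩ := comparable_of_pair_mem_treeCode (hX' _ hx _ hy)
    exact h
  -- `X` is not contained in the set `V ε`, so it has an element of rank at least `ε`; the pair `{x,
  -- x}` shows that this element is a node.
  · obtain ⟨x, hx, hxε⟩ := hub ⟨_, ZFSet.vonNeumann_mem_of_lt hε⟩
    obtain ⟨hxT, -⟩ := comparable_of_pair_mem_treeCode (hX' _ hx _ hx)
    exact ⟨⟨x, hxT⟩, hx, not_lt.1 fun h => hxε (ZFSet.mem_vonNeumann.2 h)⟩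

theorem not_boundedChains_holds_of_lt (hκ : κ.IsInaccessible)
    (hT : IsKTree (Cardinal.lift.{u + 1} κ) lt) {α : Ordinal.{u}} (hα : α < κ.ord) :
    ¬ boundedChains.Holds (V α) (treeCode T (extendRel lt) ∩ V α) := by
  rw [boundedChains_holds_iff mem_of_mem_V]
  intro h
  -- `V α` has fewer than `κ` elements, so it cannot contain all nodes.
  obtain ⟨t, ht⟩ : ∃ t : T, α ≤ t.1.1.rank := by
    by_contra! hlt
    refine (card_rank_lt hκ T hα).ne ?_
    rw [← hT.card_eq]
    exact Cardinal.mk_congr (Equiv.subtypeUnivEquiv hlt)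
  obtain ⟨-, hcover, hbdd⟩ := h {x | ∃ s : T, s.1.1 = x.1 ∧ lt s t}
  have hcomp : ∀ x ∈ {x : V α | ∃ s : T, s.1.1 = x.1 ∧ lt s t},
      ∀ y ∈ {x : V α | ∃ s : T, s.1.1 = x.1 ∧ lt s t},
      ∃ p : V α, p.1 ∈ treeCode T (extendRel lt) ∩ V α ∧ p.1 = {x.1, y.1} := by
    rintro ⟨x, hx⟩ ⟨s, rfl, hs⟩ ⟨x', hx'⟩ ⟨s', rfl, hs'⟩
    have hp : ({s.1.1, s'.1.1} : ZFSet.{u}) ∈ V α := by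
      -- The covering clause forces `α` to be closed under successors of ranks, so pairs stay in `V
      -- α`.
      have hsucc {x : ZFSet.{u}} (hx : x ∈ V α) : Order.succ x.rank < α := by
        obtain ⟨z, hxz, -⟩ := hcover ⟨x, hx⟩
        exact (Order.succ_le_of_lt (ZFSet.rank_lt_of_mem hxz)).trans_lt (mem_V_iff.1 z.2)
      rw [mem_V_iff, ZFSet.rank_pair]
      exact max_lt (hsucc hx) (hsucc hx')
    have hpκ : ({s.1.1, s'.1.1} : ZFSet.{u}) ∈ V κ.ord :=
      mem_V_iff.2 ((mem_V_iff.1 hp).trans hα)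
    refine ⟨⟨_, hp⟩, ⟨?_, hp⟩, rfl⟩
    rcases hT.isTree.comparable hs hs' with h | h | h
    · exact pair_mem_treeCode (.inr h) hpκ
    · exact pair_mem_treeCode (.inl h) hpκ
    · have hswap : ({s.1.1, s'.1.1} : ZFSet.{u}) = {s'.1.1, s.1.1} := by
        ext w; simp only [ZFSet.mem_pair, or_comm]
      simp only [hswap] at hpκ ⊢
      exact pair_mem_treeCode (.inr h) hpκ
  obtain ⟨y, hy⟩ := hbdd hcomp
  -- Closedness of `z` at `y` and `t` yields a predecessor of `t` in `V α` that `y` misses.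
  obtain ⟨z, hyz, ⟨⟨hzκ, hz⟩, -⟩, h₃⟩ := hcover y
  rcases hz with ⟨s, -, s', -, -, he⟩ | ⟨-, hz⟩
  · exact not_hasThree_pair _ _ (he ▸ h₃)
  · obtain ⟨s, hsz, ⟨hs, _, hst⟩, hsy⟩ := hz ⟨y, mem_of_mem_V _ hzκ _ hyz⟩ hyz t t.2 fun h =>
      (mem_V_iff.1 (mem_of_mem_V _ z.2 _ h)).not_ge ht
    exact hsy (hy ⟨s, mem_of_mem_V _ z.2 _ hsz⟩ ⟨⟨s, hs⟩, rfl, hst⟩)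

theorem exists_isCofinalBranch (hκ : IsPi11Reflecting κ)
    (hT : IsKTree (Cardinal.lift.{u + 1} κ) lt) (hdT : DefinableOver (V κ.ord) T)
    (hdlt : DefinableRelOver (V κ.ord) (extendRel lt)) : ∃ b : Set T, IsCofinalBranch lt b := by
  by_contra hb
  obtain ⟨α, hα, h⟩ := hκ.reflect (treeCode T (extendRel lt)) (fun _ h => h.1)
    (definableOver_treeCode mem_of_mem_V hdT hdlt) boundedChains
    (boundedChains_holds_of_not_exists_branch hκ.isInaccessible hT hb)
  exact not_boundedChains_holds_of_lt hκ.isInaccessible hT hα h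

end DefinableTree
open DefinableTree in
/-- If `κ` is `Π¹₁` reflecting, then every `κ`-tree definable in the very wide sense over `H_κ`
has a cofinal branch. -/
theorem lemma3p3 (κ : Cardinal.{u}) (hκ : IsPi11Reflecting κ) (T : Set (H κ)) (lt : T → T → Prop)
    (hT : IsKTree (Cardinal.lift.{u + 1} κ) lt) (hdef : DefinableVeryWide κ T lt) :
    ∃ b : Set T, IsCofinalBranch lt b := by
  obtain ⟨hdT, hdlt⟩ := hdef
  have hH := H_eq_V hκ.isInaccessible
  generalize H κ = M at *
  subst hH
  exact exists_isCofinalBranch hκ hT hdT hdlt
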